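/- **Setting.** A labelled stochastic transition system (LSTS) $\mathcal T=(S,\Sigma,\kappa,\mathsf{AP},\mathcal L)$ consists of a measurable space $(S,\Sigma)$, a Markov kernel $\kappa$ from $S$ to $S$, a finite set $\mathsf{AP}$ and a measurable map $\mathcal L:S\to 2^{\mathsf{AP}}$. For a probability measure $\mu$ on $S$, $\mathbb P^{\mathcal T}_\mu$ is the law on $S^{\mathbb N}$ of the Markov chain with initial distribution $\mu$ and kernel $\kappa$, and $\Omega_{\mathcal T}(\mu)(A)=\int\kappa(s,A)\,\mu(ds)$. Write $\mathbf F B$ for the set of paths that visit $B$. A set $B\in\Sigma$ is an attractor if $\mathbb P^{\mathcal T}_\mu(\mathbf F B)=1$ for every probability measure $\mu$ on $S$. $\mathcal T$ is a DMC if $S$ is countable and $\Sigma=2^S$; in a DMC, a path from $s$ to $t$ is a finite sequence of states from $s$ to $t$ (possibly of length $0$) whose steps all have positive probability. For a measurable $\alpha:S_1\to S_2$, $\mathcal T_2$ is an $\alpha$-abstraction of $\mathcal T_1$ if for every probability measure $\mu$ on $S_1$ the measures $\alpha_\#(\Omega_{\mathcal T_1}(\mu))$ and $\Omega_{\mathcal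 T_2}(\alpha_\#\mu)$ have the same null sets; for LSTSs over the same $\mathsf{AP}$ one also requires $\mathcal L_2\circ\alpha=\mathcal L_1$. It is sound if moreover, for all probability measures $\mu$ on $S_1$ and all $B\in\Sigma_2$, $\mathbb P^{\mathcal T_2}_{\alpha_\#\mu}(\mathbf F B)=1$ implies $\mathbb P^{\mathcal T_1}_{\mu}(\mathbf F\alpha^{-1}(B))=1$. A deterministic Muller automaton $\mathcal M=(Q,q_0,E,\mathcal F)$ over $\mathsf{AP}$ has a finite set $Q$ of locations, $q_0\in Q$, $E\subseteq Q\times 2^{\mathsf{AP}}\times Q$ such that for all $(q,u)$ there is exactly one $q'$ with $(q,u,q')\in E$, and $\mathcal F\subseteq 2^Q$. The product $\mathcal T\ltimes\mathcal M$ has state space $S\times Q$ (with the product $\sigma$-algebra $\Sigma\otimes 2^Q$), kernel $\kappa'((s,q),A\times\{q'\})=\kappa(s,A)$ if $(q,\mathcal L(s),q')\in E$ and $0$ otherwise, and the state $(s,q)$ is labelled by $q$. For a path $\rho$ of the product, $\mathsf{Inf}(\rho)\subseteq Q$ is the set of locations visited infinitely often. Put $\alpha_{\mathcal M}(s,q)=(\alpha(s),q)$.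 For a DMC $\mathcal T$ and a finite attractor $B$ of $\mathcal T\ltimes\mathcal M$, let $\mathsf{Graph}(B)$ be the directed graph with vertex set $B$ and an edge from $x$ to $y$ whenever there is a path from $x$ to $y$ in $\mathcal T\ltimes\mathcal M$. A bottom strongly connected component (BSCC) is a strongly connected component that no edge leaves. A BSCC $C$ of $\mathsf{Graph}(B)$ is good for $\mathcal F$ if there is $F\in\mathcal F$ such that (a) whenever there is a path in $\mathcal T\ltimes\mathcal M$ from an element of $C$ to $(s,q)$, then $q\in F$; and (b) for every $q\in F$ there are $s\in S$ and a path from an element of $C$ to $(s,q)$. Let $\mathsf{Good}^{B}_{\mathcal T\ltimes\mathcal M}(\mathcal F)$ be the set of these. **Theorem.** Let $\mathcal T_1,\mathcal T_2$ be LSTSs over the same $\mathsf{AP}$ such that $\mathcal T_2$ is a DMC with a finite attractor and is an $\alpha$-abstraction of $\mathcal T_1$. Let $\mathcal M=(Q,q_0,E,\mathcal F)$ be a deterministic Muller automaton over $\mathsf{AP}$. Assume that $\mathcal T_2\ltimes\mathcal M$ is a sound $\alpha_{\mathcal M}$-abstraction of $\mathcal T_1\ltimes\mathcal M$, and let $B_2$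 be a finite attractor of $\mathcal T_2\ltimes\mathcal M$. Then for every probability measure $\mu$ on $S_1$, $$\mathbb P^{\mathcal T_1\ltimes\mathcal M}_{\mu\times\delta_{q_0}}(\mathsf{Inf}\in\mathcal F)=\sum_{C\in\mathsf{Good}^{B_2}_{\mathcal T_2\ltimes\mathcal M}(\mathcal F)}\mathbb P^{\mathcal T_1\ltimes\mathcal M}_{\mu\times\delta_{q_0}}\bigl(\mathbf F\,\alpha_{\mathcal M}^{-1}(C)\bigr).$$ -/

import Mathlib

open MeasureTheory ProbabilityTheory

/-- A stochastic transition system on the measurable space `S`: a Markov kernel from `S` to `S`. -/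
structure STS (S : Type*) [MeasurableSpace S] where
  kernel : Kernel S S
  markov : IsMarkovKernel kernel

namespace STS

variable {S : Type*} [MeasurableSpace S]

instance instMarkovKernel (T : STS S) : IsMarkovKernel T.kernel := T.markov

/-- The kernel giving the next state from a history of states: it only looks at the last state. -/
noncomputable def stepKernel (T : STS S) (n : ℕ) :
    Kernel (Π _ : Finset.Iic n, S) S :=
  T.kernel.comap (fun x => x ⟨n, Finset.mem_Iic.2 le_rfl⟩) (measurable_pi_apply _)

instance instMarkovStep (T : STS S) (n : ℕ) : IsMarkovKernel (T.stepKernel n) := by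
  unfold stepKernel; infer_instance

/-- The law on infinite paths `ℕ → S` (with the `σ`-algebra generated by the cylinders) of the
system started from the initial distribution `μ`. -/
noncomputable def pathMeasure (T : STS S) (μ : Measure S) : Measure (ℕ → S) :=
  Kernel.trajMeasure (X := fun _ : ℕ => S) μ T.stepKernel

/-- One step of the system as a transformer of distributions:
`transform T μ A = ∫ κ(s, A) μ(ds)`. -/
noncomputable def transform (T : STS S) (μ : Measure S) : Measure S :=
  μ.bind T.kernel

/-- `B` is an attractor: from every initial distribution, `B` is reached almost surely. -/
def IsAttractor (T : STS S) (B : Set S) : Prop :=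
  MeasurableSet B ∧
    ∀ μ : Measure S, IsProbabilityMeasure μ → T.pathMeasure μ {ρ | ∃ n, ρ n ∈ B} = 1

/-- There is a finite path from `s` to `t`, each of whose steps has positive probability
(meant for denumerable state spaces with the discrete `σ`-algebra). -/
def HasPath (T : STS S) (s t : S) : Prop :=
  Relation.ReflTransGen (fun x y => 0 < T.kernel x {y}) s t

/-- The graph whose vertices are the elements of `B`, with an edge from `x` to `y` if there is a
path from `x` to `y` in the system. -/
def graph (T : STS S) (B : Set S) : Digraph B where
  Adj x y := T.HasPath x y

end STS

/-- Two measures have the same measurable null sets. -/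
def QualEquiv {S : Type*} [MeasurableSpace S] (μ ν : Measure S) : Prop :=
  ∀ A, MeasurableSet A → (μ A = 0 ↔ ν A = 0)

/-- `T₂` is an `α`-abstraction of `T₁`. -/
def STS.IsAbstraction {S₁ S₂ : Type*} [MeasurableSpace S₁] [MeasurableSpace S₂]
    (α : S₁ → S₂) (T₁ : STS S₁) (T₂ : STS S₂) : Prop :=
  Measurable α ∧ ∀ μ : Measure S₁, IsProbabilityMeasure μ →
    QualEquiv ((T₁.transform μ).map α) (T₂.transform (μ.map α))

/-- `T₂` is a sound `α`-abstraction of `T₁`: it is an `α`-abstraction, and almost sure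
reachability of `B` in `T₂` implies almost sure reachability of `α⁻¹(B)` in `T₁`, from every
initial distribution. -/
def STS.IsSoundAbstraction {S₁ S₂ : Type*} [MeasurableSpace S₁] [MeasurableSpace S₂]
    (α : S₁ → S₂) (T₁ : STS S₁) (T₂ : STS S₂) : Prop :=
  STS.IsAbstraction α T₁ T₂ ∧
    ∀ μ : Measure S₁, IsProbabilityMeasure μ → ∀ B : Set S₂, MeasurableSet B →
      T₂.pathMeasure (μ.map α) {ρ | ∃ n, ρ n ∈ B} = 1 →
        T₁.pathMeasure μ {ρ | ∃ n, ρ n ∈ α ⁻¹' B} = 1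

/-- A strongly connected component of a directed graph: a class of mutually reachable vertices. -/
def Digraph.IsSCC {V : Type*} (G : Digraph V) (C : Set V) : Prop :=
  ∃ v, C = {w | Relation.ReflTransGen G.Adj v w ∧ Relation.ReflTransGen G.Adj w v}

/-- A bottom strongly connected component: one that no edge leaves. -/
def Digraph.IsBSCC {V : Type*} (G : Digraph V) (C : Set V) : Prop :=
  G.IsSCC C ∧ ∀ x ∈ C, ∀ y, G.Adj x y → y ∈ C

/-- A labelled stochastic transition system with atomic propositions `AP` (finite in all uses, so
that the `σ`-algebra of `Set AP` is the full power set). -/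
structure LSTS (AP S : Type*) [MeasurableSpace S] extends STS S where
  label : S → Set AP
  measurable_label : Measurable label

/-- The set of atomic propositions that hold infinitely often along a path. -/
def LSTS.inf {AP S : Type*} [MeasurableSpace S] (T : LSTS AP S) (ρ : ℕ → S) : Set AP :=
  {a | {j : ℕ | a ∈ T.label (ρ j)}.Infinite}

/-- `α`-abstraction for labelled systems over the same atomic propositions. -/
structure LSTS.IsAbstraction {AP S₁ S₂ : Type*} [MeasurableSpace S₁] [MeasurableSpace S₂]
    (α : S₁ → S₂) (T₁ : LSTS AP S₁) (T₂ : LSTS AP S₂) : Prop where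
  sts : STS.IsAbstraction α T₁.toSTS T₂.toSTS
  label_closed : ∀ s s', α s = α s' → T₁.label s = T₁.label s'
  label_eq : ∀ s, T₂.label (α s) = T₁.label s

/-- A deterministic (and complete) Muller automaton over `AP` with set of locations `Q`. -/
structure DMA (AP Q : Type*) where
  init : Q
  edges : Set (Q × Set AP × Q)
  muller : Set (Set Q)
  deterministic : ∀ q u q₁ q₂, (q, u, q₁) ∈ edges → (q, u, q₂) ∈ edges → q₁ = q₂
  complete : ∀ q u, ∃ q', (q, u, q') ∈ edges

/-- The unique location `q'` such that `(q, u, q')` is an edge. -/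
noncomputable def DMA.next {AP Q : Type*} (M : DMA AP Q) (q : Q) (u : Set AP) : Q :=
  (M.complete q u).choose

/-- The lifting `(s, q) ↦ (α s, q)`. -/
def liftProd {S₁ S₂ : Type*} (Q : Type*) (α : S₁ → S₂) (x : S₁ × Q) : S₂ × Q :=
  (α x.1, x.2)

section Product

variable {AP S Q : Type*} [MeasurableSpace S] [Finite AP] [Finite Q] [MeasurableSpace Q]
  [DiscreteMeasurableSpace Q]

theorem LSTS.measurable_next (T : LSTS AP S) (M : DMA AP Q) :
    Measurable (fun x : S × Q => M.next x.2 (T.label x.1)) := by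
  have h : Measurable (fun p : Q × Set AP => M.next p.1 p.2) := Measurable.of_discrete
  exact h.comp (measurable_snd.prodMk (T.measurable_label.comp measurable_fst))

/-- The product of a labelled system with a Muller automaton: from `(s, q)` the first component
moves according to `κ(s, ·)`, the second one moves to the location `q'` with
`(q, label s, q') ∈ E`. The state `(s, q)` is labelled by `q`. -/
noncomputable def LSTS.product (T : LSTS AP S) (M : DMA AP Q) : LSTS Q (S × Q) where
  kernel := (Kernel.prodMkRight Q T.kernel) ×ₖ
    (Kernel.deterministic (fun x : S × Q => M.next x.2 (T.label x.1)) (T.measurable_next M))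
  markov := inferInstance
  label x := {x.2}
  measurable_label :=
    (Measurable.of_discrete (f := fun q : Q => ({q} : Set Q))).comp measurable_snd

end Product

/-- The BSCCs `C` of the graph of `B` (as sets of states) which are good for the Muller condition
`𝓕`: some `F ∈ 𝓕` consists exactly of the locations that are reachable from `C`. -/
def goodBSCCs {S Q : Type*} [MeasurableSpace S] [MeasurableSpace Q] (T : STS (S × Q))
    (B : Set (S × Q)) (𝓕 : Set (Set Q)) : Set (Set (S × Q)) :=
  {C | (∃ D : Set B, (T.graph B).IsBSCC D ∧ C = Subtype.val '' D) ∧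
    ∃ F ∈ 𝓕,
      (∀ s q, (∃ c ∈ C, T.HasPath c (s, q)) → q ∈ F) ∧
      (∀ q ∈ F, ∃ s, ∃ c ∈ C, T.HasPath c (s, q))}
/-!
The avoidance probability `x ↦ ℙ_x(∀ n, ρ n ∉ U)` is subharmonic. If `A` is a finite attractor, it
is bounded, on the states reachable from `x`, by its maximum over those in `A` (maximum principle),
and at a state where this maximum is attained it is equal to its value at every reachable state
(strong maximum principle). Hence it vanishes as soon as `U` can be reached from every reachable
state of `A`. Consequently, the BSCCs of the graph of `A` are almost surely reached, and every state
reachable from a BSCC is almost surely visited from every other such state.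

Let now `T₂` be a sound abstraction of `T₁` through `β`. The image under `β` of a path `ρ` of `T₁`
is almost surely a path of `T₂`, and it inherits almost sure reachability from `T₂` at all times:
almost surely, it visits exactly one BSCC `C`, then stays among the states reachable from `C` and
visits each of them infinitely often. The labels seen infinitely often along `ρ` are therefore
exactly those of the states reachable from `C`.
-/


section Trajectories

theorem comp_map_eq_comap_comp {X Y Z : Type*} [MeasurableSpace X] [MeasurableSpace Y]
    [MeasurableSpace Z] (μ : Measure X) (κ : Kernel Y Z) {f : X → Y} (hf : Measurable f) :
    κ ∘ₘ μ.map f = κ.comap f hf ∘ₘ μ := by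
  rw [← Measure.deterministic_comp_eq_map hf, Measure.comp_assoc,
    Kernel.comp_deterministic_eq_comap]

theorem map_compProd_eq_map_compProd_comap {X Y Z : Type*} [MeasurableSpace X]
    [MeasurableSpace Y] [MeasurableSpace Z] (μ : Measure X) [SFinite μ] (κ : Kernel Y Z)
    [IsSFiniteKernel κ] {f : X → Y} (hf : Measurable f) :
    μ.map f ⊗ₘ κ = (μ ⊗ₘ κ.comap f hf).map (Prod.map f id) := by
  ext A hA
  rw [Measure.compProd_apply hA, lintegral_map (Kernel.measurable_kernel_prodMk_left hA) hf,
    Measure.map_apply (by fun_prop) hA, Measure.compProd_apply (hA.preimage (by fun_prop))]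
  rfl

variable {X : ℕ → Type*} [∀ n, MeasurableSpace (X n)] {μ₀ : Measure (X 0)}
  {κ : (n : ℕ) → Kernel (Π i : Finset.Iic n, X i) (X (n + 1))} [∀ n, IsMarkovKernel (κ n)]

/-- A trajectory up to time `0` is the same as its initial state. It retypes
`MeasurableEquiv.piUnique`, whose codomain is only definitionally equal to `X 0`. -/
def initialStateEquiv (X : ℕ → Type*) [∀ n, MeasurableSpace (X n)] :
    (Π i : Finset.Iic 0, X i) ≃ᵐ X 0 :=
  MeasurableEquiv.piUnique fun i : Finset.Iic 0 => X i

theorem map_frestrictLe_zero_trajMeasure :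
    (Kernel.trajMeasure μ₀ κ).map (Preorder.frestrictLe 0) = μ₀.map (initialStateEquiv X).symm := by
  rw [Kernel.trajMeasure, Measure.map_comp _ _ (by fun_prop), Kernel.traj_map_frestrictLe,
    Kernel.partialTraj_self, Measure.id_comp]
  rfl

theorem map_eval_zero_trajMeasure : (Kernel.trajMeasure μ₀ κ).map (fun x => x 0) = μ₀ := by
  let e := initialStateEquiv X
  have heval : (fun x : Π n, X n => x 0) = e ∘ Preorder.frestrictLe 0 := rfl
  rw [heval, ← Measure.map_map e.measurable (by fun_prop), map_frestrictLe_zero_trajMeasure,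
    Measure.map_map e.measurable e.symm.measurable, e.self_comp_symm, Measure.map_id]

theorem map_frestrictLe_eq_of_compProd_eq_map [IsProbabilityMeasure μ₀] {ν : Measure (Π n, X n)}
    (hzero : ν.map (fun x => x 0) = μ₀)
    (hsucc : ∀ n, ν.map (Preorder.frestrictLe n) ⊗ₘ κ n =
      ν.map fun x => (Preorder.frestrictLe n x, x (n + 1))) (n : ℕ) :
    ν.map (Preorder.frestrictLe n) =
      (Kernel.trajMeasure μ₀ κ).map (Preorder.frestrictLe n) := by
  induction n with
  | zero =>
    have hrestrict : Preorder.frestrictLe 0 =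
        (initialStateEquiv X).symm ∘ fun x : Π n, X n => x 0 :=
      funext fun x => ((initialStateEquiv X).symm_apply_apply _).symm
    rw [map_frestrictLe_zero_trajMeasure, ← hzero, hrestrict,
      Measure.map_map (MeasurableEquiv.measurable _) (by fun_prop)]
  | succ n ih =>
    let glue : (Π i : Finset.Iic n, X i) × X (n + 1) → Π i : Finset.Iic (n + 1), X i :=
      IicProdIoc n (n + 1) ∘ Prod.map id (MeasurableEquiv.piSingleton n)
    have hglue : Measurable glue := by fun_prop
    have hrestrict : Preorder.frestrictLe (n + 1) =
        glue ∘ fun x : Π n, X n => (Preorder.frestrictLe n x, x (n + 1)) := by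
      ext x i
      rcases Nat.le_succ_iff.1 (Finset.mem_Iic.1 i.2) with h | h
      · simp [glue, IicProdIoc, h]
      · obtain ⟨i, hi⟩ := i
        subst h
        simp [glue, IicProdIoc, MeasurableEquiv.piSingleton]
    rw [hrestrict, ← Measure.map_map hglue (by fun_prop), ← hsucc, ih,
      Kernel.map_frestrictLe_trajMeasure_compProd_eq_map_trajMeasure,
      Measure.map_map hglue (by fun_prop)]

theorem eq_trajMeasure_of_compProd_eq_map [IsProbabilityMeasure μ₀] {ν : Measure (Π n, X n)}
    [IsProbabilityMeasure ν] (hzero : ν.map (fun x => x 0) = μ₀)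
    (hsucc : ∀ n, ν.map (Preorder.frestrictLe n) ⊗ₘ κ n =
      ν.map fun x => (Preorder.frestrictLe n x, x (n + 1))) :
    ν = Kernel.trajMeasure μ₀ κ := by
  refine IsProjectiveLimit.unique (P := fun I => ν.map I.restrict) (fun _ => rfl) ?_
  refine (isProjectiveLimit_nat_iff ?_ _).2 fun n =>
    (map_frestrictLe_eq_of_compProd_eq_map hzero hsucc n).symm
  exact isProjectiveMeasureFamily_map_restrict (X := fun n (x : Π n, X n) => x n) fun n =>
    (measurable_pi_apply n).aemeasurable

end Trajectories

namespace STS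

section MarkovProperty

variable {S : Type*} [MeasurableSpace S] (T : STS S)

/-- The law of the paths starting in a given state, as a kernel in that state. -/
noncomputable def pathKernel : Kernel S (ℕ → S) :=
  (Kernel.traj (X := fun _ : ℕ => S) T.stepKernel 0).comap
    (initialStateEquiv fun _ => S).symm (MeasurableEquiv.measurable _)

instance isMarkovKernel_pathKernel : IsMarkovKernel T.pathKernel := by
  unfold pathKernel; infer_instance

theorem pathMeasure_eq_comp (μ : Measure S) : T.pathMeasure μ = T.pathKernel ∘ₘ μ :=
  comp_map_eq_comap_comp μ _ (MeasurableEquiv.measurable _)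

theorem pathMeasure_dirac (x : S) : T.pathMeasure (Measure.dirac x) = T.pathKernel x := by
  rw [pathMeasure_eq_comp, Measure.dirac_bind (Kernel.measurable _)]

instance isProbabilityMeasure_pathMeasure (μ : Measure S) [IsProbabilityMeasure μ] :
    IsProbabilityMeasure (T.pathMeasure μ) := by
  unfold pathMeasure; infer_instance

instance isProbabilityMeasure_transform (μ : Measure S) [IsProbabilityMeasure μ] :
    IsProbabilityMeasure (T.transform μ) := by
  unfold transform; infer_instance

theorem transform_dirac (x : S) : T.transform (Measure.dirac x) = T.kernel x :=
  Measure.dirac_bind (Kernel.measurable _) _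

theorem pathMeasure_map_zero (μ : Measure S) : (T.pathMeasure μ).map (fun ρ => ρ 0) = μ :=
  map_eval_zero_trajMeasure

theorem map_frestrictLe_pathMeasure_compProd (μ : Measure S) [IsProbabilityMeasure μ] (n : ℕ) :
    (T.pathMeasure μ).map (Preorder.frestrictLe n) ⊗ₘ T.stepKernel n =
      (T.pathMeasure μ).map fun ρ => (Preorder.frestrictLe n ρ, ρ (n + 1)) :=
  Kernel.map_frestrictLe_trajMeasure_compProd_eq_map_trajMeasure

theorem pathMeasure_map_succ (μ : Measure S) [IsProbabilityMeasure μ] (n : ℕ) :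
    (T.pathMeasure μ).map (fun ρ => ρ (n + 1)) =
      T.transform ((T.pathMeasure μ).map fun ρ => ρ n) := by
  have h := congrArg Measure.snd (T.map_frestrictLe_pathMeasure_compProd μ n)
  rw [Measure.snd_compProd, Measure.snd, Measure.map_map (by fun_prop) (by fun_prop), stepKernel,
    ← comp_map_eq_comap_comp, Measure.map_map (by fun_prop) (by fun_prop)] at h
  exact h.symm

theorem pathMeasure_map_shift (μ : Measure S) [IsProbabilityMeasure μ] :
    (T.pathMeasure μ).map (fun ρ n => ρ (n + 1)) = T.pathMeasure (T.transform μ) := by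
  let shift : (ℕ → S) → ℕ → S := fun ρ n => ρ (n + 1)
  have hshift : Measurable shift := by fun_prop
  have : IsProbabilityMeasure ((T.pathMeasure μ).map shift) :=
    Measure.isProbabilityMeasure_map hshift.aemeasurable
  refine eq_trajMeasure_of_compProd_eq_map ?_ fun n => ?_
  · rw [Measure.map_map (by fun_prop) hshift]
    exact (T.pathMeasure_map_succ μ 0).trans (by rw [pathMeasure_map_zero])
  · let tail : (Π _ : Finset.Iic (n + 1), S) → Π _ : Finset.Iic n, S := fun x i =>
      x ⟨i + 1, Finset.mem_Iic.2 (Nat.succ_le_succ (Finset.mem_Iic.1 i.2))⟩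
    have htail : Measurable tail := by fun_prop
    calc ((T.pathMeasure μ).map shift).map (Preorder.frestrictLe n) ⊗ₘ T.stepKernel n
        = ((T.pathMeasure μ).map (Preorder.frestrictLe (n + 1))).map tail ⊗ₘ T.stepKernel n := by
          rw [Measure.map_map (by fun_prop) hshift, Measure.map_map htail (by fun_prop)]
          rfl
      _ = ((T.pathMeasure μ).map (Preorder.frestrictLe (n + 1)) ⊗ₘ T.stepKernel (n + 1)).map
            (Prod.map tail id) := map_compProd_eq_map_compProd_comap _ _ htail
      _ = ((T.pathMeasure μ).map shift).map
            fun ρ => (Preorder.frestrictLe n ρ, ρ (n + 1)) := by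
          rw [map_frestrictLe_pathMeasure_compProd, Measure.map_map (by fun_prop) (by fun_prop),
            Measure.map_map (by fun_prop) hshift]
          rfl

theorem pathKernel_map_shift (x : S) :
    (T.pathKernel x).map (fun ρ n => ρ (n + 1)) = T.pathKernel ∘ₘ T.kernel x := by
  rw [← pathMeasure_dirac, pathMeasure_map_shift, transform_dirac, pathMeasure_eq_comp]

theorem ae_pathMeasure_forall_shift {p : (ℕ → S) → Prop} (hp : MeasurableSet {ρ | p ρ})
    (h : ∀ x, ∀ᵐ ρ ∂T.pathKernel x, p ρ) (μ : Measure S) [IsProbabilityMeasure μ] :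
    ∀ᵐ ρ ∂T.pathMeasure μ, ∀ n, p fun k => ρ (n + k) := by
  rw [ae_all_iff]
  intro n
  induction n generalizing μ with
  | zero =>
    simp only [Nat.zero_add, pathMeasure_eq_comp]
    exact Measure.ae_comp_of_ae_ae hp (ae_of_all _ h)
  | succ n ih =>
    have hn := ih (T.transform μ)
    rw [← pathMeasure_map_shift] at hn
    simp only [Nat.add_right_comm n 1]
    have hshift : Measurable fun (ρ : ℕ → S) n => ρ (n + 1) := by fun_prop
    exact ae_of_ae_map hshift.aemeasurable hn

theorem ae_pathKernel_zero_mem {V : Set S} (hV : MeasurableSet V) {x : S} (hx : x ∈ V) :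
    ∀ᵐ ρ ∂T.pathKernel x, ρ 0 ∈ V := by
  refine ae_of_ae_map (f := fun ρ : ℕ → S => ρ 0) (p := (· ∈ V))
    (measurable_pi_apply 0).aemeasurable ?_
  rw [← pathMeasure_dirac, pathMeasure_map_zero]
  exact (ae_dirac_iff hV).2 hx

theorem ae_pathKernel_one {p : S → Prop} {x : S} (h : ∀ᵐ y ∂T.kernel x, p y) :
    ∀ᵐ ρ ∂T.pathKernel x, p (ρ 1) := by
  refine ae_of_ae_map (f := fun ρ : ℕ → S => ρ 1) (p := p)
    (measurable_pi_apply 1).aemeasurable ?_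
  rwa [← pathMeasure_dirac, pathMeasure_map_succ, pathMeasure_map_zero, transform_dirac]

end MarkovProperty

section Hitting

variable {S : Type*} [MeasurableSpace S]

theorem measurableSet_hits {U : Set S} (hU : MeasurableSet U) :
    MeasurableSet {ρ : ℕ → S | ∃ n, ρ n ∈ U} := by
  rw [Set.ofPred_exists]
  exact .iUnion fun n => measurable_pi_apply n hU

theorem measurableSet_avoids {U : Set S} (hU : MeasurableSet U) :
    MeasurableSet {ρ : ℕ → S | ∀ n, ρ n ∉ U} := by
  rw [Set.ofPred_forall]
  exact .iInter fun n => (measurable_pi_apply n hU).compl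

theorem measurableSet_avoids_before {U : Set S} (hU : MeasurableSet U) (n : ℕ) :
    MeasurableSet {ρ : ℕ → S | ∀ k < n, ρ k ∉ U} := by
  simp only [Set.ofPred_forall]
  exact .iInter fun k => .iInter fun _ => (measurable_pi_apply k hU).compl

variable (T : STS S)

/-- Almost every path starting in `x` visits `U`. -/
def ReachesAlmostSurely (x : S) (U : Set S) : Prop :=
  ∀ᵐ ρ ∂T.pathKernel x, ∃ n, ρ n ∈ U

/-- The probability that a path starting in `x` never visits `U`. -/
noncomputable def avoidProb (U : Set S) (x : S) : ENNReal :=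
  T.pathKernel x {ρ | ∀ n, ρ n ∉ U}

/-- The probability that a path starting in `x` does not visit `U` at the times
`0, …, n - 1`. -/
noncomputable def avoidProbBefore (U : Set S) (n : ℕ) (x : S) : ENNReal :=
  T.pathKernel x {ρ | ∀ k < n, ρ k ∉ U}

variable {T}

theorem pathMeasure_hits_eq_one_iff {U : Set S} (hU : MeasurableSet U) {μ : Measure S}
    [IsProbabilityMeasure μ] :
    T.pathMeasure μ {ρ | ∃ n, ρ n ∈ U} = 1 ↔ ∀ᵐ ρ ∂T.pathMeasure μ, ∃ n, ρ n ∈ U :=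
  (mem_ae_iff_prob_eq_one (measurableSet_hits hU)).symm

theorem reachesAlmostSurely_iff_pathMeasure_dirac {U : Set S} (hU : MeasurableSet U) {x : S} :
    T.ReachesAlmostSurely x U ↔ T.pathMeasure (Measure.dirac x) {ρ | ∃ n, ρ n ∈ U} = 1 := by
  rw [pathMeasure_hits_eq_one_iff hU, pathMeasure_dirac, ReachesAlmostSurely]

theorem IsAttractor.reachesAlmostSurely {A : Set S} (hA : T.IsAttractor A) (x : S) :
    T.ReachesAlmostSurely x A :=
  (reachesAlmostSurely_iff_pathMeasure_dirac hA.1).2 (hA.2 _ inferInstance)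

theorem reachesAlmostSurely_of_mem {U : Set S} (hU : MeasurableSet U) {x : S} (hx : x ∈ U) :
    T.ReachesAlmostSurely x U :=
  (T.ae_pathKernel_zero_mem hU hx).mono fun _ hρ => ⟨0, hρ⟩

theorem avoidProb_eq_zero_iff {U : Set S} {x : S} :
    T.avoidProb U x = 0 ↔ T.ReachesAlmostSurely x U := by
  simp only [avoidProb, ReachesAlmostSurely, ae_iff, not_exists]

theorem avoidProb_le_one (U : Set S) (x : S) : T.avoidProb U x ≤ 1 :=
  prob_le_one

theorem avoidProbBefore_zero (U : Set S) (x : S) : T.avoidProbBefore U 0 x = 1 := by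
  simp [avoidProbBefore]

theorem tendsto_avoidProbBefore {U : Set S} (hU : MeasurableSet U) (x : S) :
    Filter.Tendsto (fun n => T.avoidProbBefore U n x) Filter.atTop (nhds (T.avoidProb U x)) := by
  have hinter : {ρ : ℕ → S | ∀ n, ρ n ∉ U} = ⋂ n, {ρ | ∀ k < n, ρ k ∉ U} := by
    ext ρ
    simp only [Set.mem_ofPred_eq, Set.mem_iInter]
    exact ⟨fun h _ k _ => h k, fun h n => h (n + 1) n n.lt_succ_self⟩
  rw [avoidProb, hinter]
  exact tendsto_measure_iInter_atTop
    (fun n => (measurableSet_avoids_before hU n).nullMeasurableSet)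
    (fun _ _ hmn _ hρ k hk => hρ k (hk.trans_le hmn)) ⟨0, measure_ne_top _ _⟩

theorem lintegral_pathKernel_apply (x : S) {N : Set (ℕ → S)} (hN : MeasurableSet N) :
    ∫⁻ y, T.pathKernel y N ∂T.kernel x = T.pathKernel x {ρ | (fun n => ρ (n + 1)) ∈ N} := by
  have hshift : Measurable fun (ρ : ℕ → S) n => ρ (n + 1) := by fun_prop
  rw [← Measure.bind_apply hN (Kernel.aemeasurable _), ← pathKernel_map_shift,
    Measure.map_apply hshift hN]
  rfl

theorem avoidProb_le_lintegral {U : Set S} (hU : MeasurableSet U) (x : S) :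
    T.avoidProb U x ≤ ∫⁻ y, T.avoidProb U y ∂T.kernel x := by
  simp only [avoidProb, lintegral_pathKernel_apply x (measurableSet_avoids hU)]
  exact measure_mono fun ρ hρ n => hρ (n + 1)

theorem lintegral_avoidProbBefore_le {U : Set S} (hU : MeasurableSet U) {x : S} (hx : x ∉ U)
    (n : ℕ) : ∫⁻ y, T.avoidProbBefore U n y ∂T.kernel x ≤ T.avoidProbBefore U (n + 1) x := by
  simp only [avoidProbBefore, lintegral_pathKernel_apply x (measurableSet_avoids_before hU n)]
  refine measure_mono_ae ?_
  filter_upwards [T.ae_pathKernel_zero_mem hU.compl hx] with ρ hzero hsucc k hk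
  cases k with
  | zero => exact hzero
  | succ k => exact hsucc k (Nat.lt_of_succ_lt_succ hk)

end Hitting

section MaximumPrinciple

variable {S : Type*} [MeasurableSpace S] (T : STS S)

/-- `R` is absorbing: from a state of `R`, the next state is almost surely in `R`. -/
def IsAbsorbing (R : Set S) : Prop :=
  ∀ x ∈ R, ∀ᵐ y ∂T.kernel x, y ∈ R

/-- `f` is subharmonic on `R`: on `R`, it is bounded by its expectation after one step. No
measurability of `f` is required, the expectation being a lower integral. -/
def IsSubharmonicOn (f : S → ENNReal) (R : Set S) : Prop :=
  ∀ x ∈ R, f x ≤ ∫⁻ y, f y ∂T.kernel x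

variable {T} {f : S → ENNReal}

theorem isSubharmonicOn_avoidProb {U : Set S} (hU : MeasurableSet U) (R : Set S) :
    T.IsSubharmonicOn (T.avoidProb U) R :=
  fun x _ => avoidProb_le_lintegral hU x

theorem IsSubharmonicOn.le_add_mul_avoidProbBefore {A R : Set S} {c H : ENNReal}
    (hA : MeasurableSet A) (hR : T.IsAbsorbing R) (hf : T.IsSubharmonicOn f (R \ A)) (hc : c ≠ ⊤)
    (hfc : ∀ x ∈ R, f x ≤ c) (hfH : ∀ x ∈ R ∩ A, f x ≤ H) (n : ℕ) :
    ∀ x ∈ R, f x ≤ H + c * T.avoidProbBefore A n x := by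
  induction n with
  | zero =>
    intro x hx
    rw [avoidProbBefore_zero, mul_one]
    exact (hfc x hx).trans le_add_self
  | succ n ih =>
    intro x hx
    by_cases hxA : x ∈ A
    · exact (hfH x ⟨hx, hxA⟩).trans le_self_add
    calc f x ≤ ∫⁻ y, f y ∂T.kernel x := hf x ⟨hx, hxA⟩
      _ ≤ ∫⁻ y, (H + c * T.avoidProbBefore A n y) ∂T.kernel x :=
        lintegral_mono_ae ((hR x hx).mono ih)
      _ = H + c * ∫⁻ y, T.avoidProbBefore A n y ∂T.kernel x := by
        rw [lintegral_add_left measurable_const, lintegral_const, measure_univ, mul_one,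
          lintegral_const_mul' _ _ hc]
      _ ≤ H + c * T.avoidProbBefore A (n + 1) x := by
        gcongr
        exact lintegral_avoidProbBefore_le hA hxA n

theorem IsSubharmonicOn.le_of_le_on_inter {A R : Set S} {c H : ENNReal} (hA : MeasurableSet A)
    (hR : T.IsAbsorbing R) (hf : T.IsSubharmonicOn f (R \ A)) (hc : c ≠ ⊤)
    (hfc : ∀ x ∈ R, f x ≤ c) (hfH : ∀ x ∈ R ∩ A, f x ≤ H) {x : S} (hx : x ∈ R)
    (hxA : T.ReachesAlmostSurely x A) : f x ≤ H := by
  have hlim := tendsto_avoidProbBefore (T := T) hA x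
  rw [avoidProb_eq_zero_iff.2 hxA] at hlim
  have hbound : Filter.Tendsto (fun n => H + c * T.avoidProbBefore A n x) Filter.atTop
      (nhds (H + c * 0)) :=
    (ENNReal.Tendsto.const_mul hlim (Or.inr hc)).const_add H
  rw [mul_zero, add_zero] at hbound
  exact ge_of_tendsto' hbound fun n => hf.le_add_mul_avoidProbBefore hA hR hc hfc hfH n x hx

section Countable

variable [Countable S]

theorem ae_kernel_singleton_pos (T : STS S) (x : S) : ∀ᵐ y ∂T.kernel x, 0 < T.kernel x {y} :=
  ae_iff_of_countable.2 fun _ hy => pos_iff_ne_zero.2 hy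

theorem isAbsorbing_setOf_hasPath (T : STS S) (x : S) : T.IsAbsorbing {y | T.HasPath x y} :=
  fun y hxy => (T.ae_kernel_singleton_pos y).mono fun _ hyz => Relation.ReflTransGen.tail hxy hyz

theorem IsSubharmonicOn.eq_of_hasPath {a : S} (hf : T.IsSubharmonicOn f {y | T.HasPath a y})
    (ha : f a ≠ ⊤) (hmax : ∀ y, T.HasPath a y → f y ≤ f a) {y : S} (hy : T.HasPath a y) :
    f y = f a := by
  induction hy with
  | refl => rfl
  | @tail y z hay hyz ih =>
    have hle : ∀ᵐ w ∂T.kernel y, f w ≤ f a :=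
      (T.isAbsorbing_setOf_hasPath a y hay).mono fun w haw => hmax w haw
    have hconst : ∫⁻ _, f a ∂T.kernel y = f a := by
      rw [lintegral_const, measure_univ, mul_one]
    have heq : f =ᵐ[T.kernel y] fun _ => f a :=
      ae_eq_of_ae_le_of_lintegral_le hle
        (ne_top_of_le_ne_top ha ((lintegral_mono_ae hle).trans hconst.le))
        aemeasurable_const (by rw [hconst, ← ih]; exact hf y hay)
    exact ae_iff_of_countable.1 heq z hyz.ne'

variable [MeasurableSingletonClass S]

theorem IsAttractor.reachesAlmostSurely_of_finite {A U : Set S} (hA : T.IsAttractor A)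
    (hfin : A.Finite) {x : S} (h : ∀ a ∈ A, T.HasPath x a → ∃ u ∈ U, T.HasPath a u) :
    T.ReachesAlmostSurely x U := by
  have hU : MeasurableSet U := U.to_countable.measurableSet
  let R : Set S := {y | T.HasPath x y}
  have hbound {H : ENNReal} (hH : ∀ a ∈ R ∩ A, T.avoidProb U a ≤ H) {y : S} (hy : y ∈ R) :
      T.avoidProb U y ≤ H :=
    (isSubharmonicOn_avoidProb hU _).le_of_le_on_inter hA.1 (T.isAbsorbing_setOf_hasPath x)
      ENNReal.one_ne_top (fun z _ => avoidProb_le_one U z) hH hy (hA.reachesAlmostSurely y)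
  have hzero : ∀ a ∈ R ∩ A, T.avoidProb U a ≤ 0 := by
    intro a ha
    obtain ⟨b, hbRA, hbmax⟩ :=
      (hfin.inter_of_right R).exists_maximalFor (T.avoidProb U) _ ⟨a, ha⟩
    have hmax (y : S) (hy : y ∈ R) : T.avoidProb U y ≤ T.avoidProb U b :=
      hbound (fun z hz => (le_total _ _).elim id (hbmax hz)) hy
    obtain ⟨u, hu, hbu⟩ := h b hbRA.2 hbRA.1
    have hub : T.avoidProb U u = T.avoidProb U b :=
      (isSubharmonicOn_avoidProb hU _).eq_of_hasPath
        (ne_top_of_le_ne_top ENNReal.one_ne_top (avoidProb_le_one U b))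
        (fun y hby => hmax y (hbRA.1.trans hby)) hbu
    rw [← avoidProb_eq_zero_iff.2 (reachesAlmostSurely_of_mem hU hu), hub]
    exact hmax a ha.1
  exact avoidProb_eq_zero_iff.1 (nonpos_iff_eq_zero.1 (hbound hzero Relation.ReflTransGen.refl))

end Countable

end MaximumPrinciple

section BSCC

variable {S : Type*} [MeasurableSpace S] (T : STS S) {B C : Set S}

/-- The states that can be reached from `C`. -/
def reachableFrom (C : Set S) : Set S :=
  {y | ∃ c ∈ C, T.HasPath c y}

/-- The BSCCs of the graph of `B`, as sets of states rather than of vertices. -/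
def bsccs (B : Set S) : Set (Set S) :=
  {C | ∃ D : Set B, (T.graph B).IsBSCC D ∧ C = Subtype.val '' D}

variable {T}

theorem reflTransGen_graph_adj_iff {v w : B} :
    Relation.ReflTransGen (T.graph B).Adj v w ↔ T.HasPath v w := by
  refine ⟨fun h => ?_, fun h => .single h⟩
  induction h with
  | refl => exact .refl
  | tail _ h ih => exact ih.trans h

theorem mem_bsccs_iff :
    C ∈ T.bsccs B ↔ C.Nonempty ∧ ∀ c ∈ C, C = {b ∈ B | T.HasPath c b} := by
  constructor
  · rintro ⟨D, ⟨⟨v, hv⟩, hclosed⟩, rfl⟩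
    refine ⟨⟨v, v, ?_, rfl⟩, ?_⟩
    · rw [hv]
      exact ⟨.refl, .refl⟩
    rintro _ ⟨c, hc, rfl⟩
    refine Set.Subset.antisymm ?_ fun b hb => ⟨⟨b, hb.1⟩, hclosed c hc _ hb.2, rfl⟩
    rintro _ ⟨b, hb, rfl⟩
    rw [hv] at hb hc
    exact ⟨b.2, reflTransGen_graph_adj_iff.1 (hc.2.trans hb.1)⟩
  · rintro ⟨⟨c, hc⟩, hC⟩
    have hCB : C ⊆ B := (hC c hc).trans_subset (Set.sep_subset B _)
    have hpath {x y : S} (hx : x ∈ C) (hy : y ∈ C) : T.HasPath x y :=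
      ((hC x hx).subset hy).2
    refine ⟨Subtype.val ⁻¹' C, ⟨⟨⟨c, hCB hc⟩, ?_⟩, fun x hx y hxy => ?_⟩,
      by rw [Subtype.image_preimage_coe, Set.inter_eq_right.2 hCB]⟩
    · ext w
      simp only [reflTransGen_graph_adj_iff]
      exact ⟨fun hw => ⟨hpath hc hw, hpath hw hc⟩, fun hw => (hC c hc).superset ⟨w.2, hw.1⟩⟩
    · exact (hC x hx).superset ⟨y.2, hxy⟩

theorem subset_of_mem_bsccs (hC : C ∈ T.bsccs B) : C ⊆ B := by
  obtain ⟨⟨c, hc⟩, h⟩ := mem_bsccs_iff.1 hC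
  exact (h c hc).trans_subset (Set.sep_subset B _)

theorem mem_of_mem_bsccs_of_hasPath (hC : C ∈ T.bsccs B) {c b : S} (hc : c ∈ C) (hb : b ∈ B)
    (h : T.HasPath c b) : b ∈ C :=
  ((mem_bsccs_iff.1 hC).2 c hc).superset ⟨hb, h⟩

theorem hasPath_of_mem_bsccs (hC : C ∈ T.bsccs B) {c y : S} (hc : c ∈ C)
    (hy : y ∈ T.reachableFrom C) : T.HasPath c y := by
  obtain ⟨c', hc', hpath⟩ := hy
  exact Relation.ReflTransGen.trans (((mem_bsccs_iff.1 hC).2 c hc).subset hc').2 hpath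

theorem eq_of_mem_bsccs {C' : Set S} (hC : C ∈ T.bsccs B) (hC' : C' ∈ T.bsccs B) {c c' : S}
    (hc : c ∈ C) (hc' : c' ∈ C') (h : T.HasPath c c') : C = C' := by
  have hc'C : c' ∈ C := mem_of_mem_bsccs_of_hasPath hC hc (subset_of_mem_bsccs hC' hc') h
  rw [(mem_bsccs_iff.1 hC).2 c' hc'C, ← (mem_bsccs_iff.1 hC').2 c' hc']

theorem exists_mem_bsccs_hasPath (hB : B.Finite) {a : S} (ha : a ∈ B) :
    ∃ u ∈ ⋃₀ T.bsccs B, T.HasPath a u := by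
  let reach (b : S) : Set S := {b' ∈ B | T.HasPath b b'}
  obtain ⟨u, hu, hmin⟩ := (hB.subset (Set.sep_subset B _ : reach a ⊆ B)).exists_minimalFor reach _
    ⟨a, ha, .refl⟩
  refine ⟨u, ⟨reach u, mem_bsccs_iff.2 ⟨⟨u, hu.1, .refl⟩, fun c hc => ?_⟩, hu.1, .refl⟩, hu.2⟩
  have hcu : reach c ⊆ reach u := fun b hb => ⟨hb.1, hc.2.trans hb.2⟩
  exact (hmin ⟨hc.1, hu.2.trans hc.2⟩ hcu).antisymm hcu

variable [Countable S] [MeasurableSingletonClass S]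

theorem IsAttractor.reachesAlmostSurely_sUnion_bsccs (hB : T.IsAttractor B) (hfin : B.Finite)
    (x : S) : T.ReachesAlmostSurely x (⋃₀ T.bsccs B) :=
  hB.reachesAlmostSurely_of_finite hfin fun _ ha _ => exists_mem_bsccs_hasPath hfin ha

theorem IsAttractor.reachesAlmostSurely_singleton (hB : T.IsAttractor B) (hfin : B.Finite)
    (hC : C ∈ T.bsccs B) {y t : S} (hy : y ∈ T.reachableFrom C) (ht : t ∈ T.reachableFrom C) :
    T.ReachesAlmostSurely y {t} := by
  refine hB.reachesAlmostSurely_of_finite hfin fun a ha hya => ⟨t, rfl, ?_⟩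
  obtain ⟨c, hc, hcy⟩ := hy
  exact hasPath_of_mem_bsccs hC (mem_of_mem_bsccs_of_hasPath hC hc ha (hcy.trans hya)) ht

end BSCC

section Abstraction

variable {S₁ S₂ : Type*} [MeasurableSpace S₁] [MeasurableSpace S₂]
  {β : S₁ → S₂} {T₁ : STS S₁} {T₂ : STS S₂}

theorem IsSoundAbstraction.reachesAlmostSurely (h : IsSoundAbstraction β T₁ T₂) {U : Set S₂}
    (hU : MeasurableSet U) {x : S₁} (hx : T₂.ReachesAlmostSurely (β x) U) :
    T₁.ReachesAlmostSurely x (β ⁻¹' U) := by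
  rw [reachesAlmostSurely_iff_pathMeasure_dirac (h.1.1 hU)]
  apply h.2 _ inferInstance U hU
  rwa [Measure.map_dirac' h.1.1, ← reachesAlmostSurely_iff_pathMeasure_dirac hU]

variable [Countable S₂] [MeasurableSingletonClass S₂]

theorem IsAbstraction.ae_kernel_singleton_pos (h : IsAbstraction β T₁ T₂) (x : S₁) :
    ∀ᵐ y ∂T₁.kernel x, 0 < T₂.kernel (β x) {β y} := by
  have hnull := (h.2 (Measure.dirac x) inferInstance {z | ¬ 0 < T₂.kernel (β x) {z}}
    (Set.to_countable _).measurableSet).2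
  rw [Measure.map_dirac' h.1, transform_dirac, transform_dirac] at hnull
  exact ae_of_ae_map h.1.aemeasurable
    (ae_iff.2 (hnull (ae_iff.1 (T₂.ae_kernel_singleton_pos _))))

theorem IsAbstraction.ae_hasPath (h : IsAbstraction β T₁ T₂) (μ : Measure S₁)
    [IsProbabilityMeasure μ] :
    ∀ᵐ ρ ∂T₁.pathMeasure μ, ∀ ⦃n m⦄, n ≤ m → T₂.HasPath (β (ρ n)) (β (ρ m)) := by
  have hβ (n : ℕ) : Measurable fun ρ : ℕ → S₁ => β (ρ n) := h.1.comp (measurable_pi_apply n)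
  have hmeas : MeasurableSet {ρ : ℕ → S₁ | 0 < T₂.kernel (β (ρ 0)) {β (ρ 1)}} :=
    (hβ 0).prodMk (hβ 1) (Set.to_countable {p : S₂ × S₂ | 0 < T₂.kernel p.1 {p.2}}).measurableSet
  have hfirst (x : S₁) : ∀ᵐ ρ ∂T₁.pathKernel x, 0 < T₂.kernel (β (ρ 0)) {β (ρ 1)} := by
    filter_upwards [T₁.ae_pathKernel_zero_mem (h.1 (measurableSet_singleton (β x))) rfl,
      T₁.ae_pathKernel_one (h.ae_kernel_singleton_pos x)] with ρ hzero hone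
    rwa [show β (ρ 0) = β x from hzero]
  filter_upwards [T₁.ae_pathMeasure_forall_shift hmeas hfirst μ] with ρ hstep n m hnm
  induction m, hnm using Nat.le_induction with
  | base => exact .refl
  | succ m _ ih => exact ih.tail (hstep m)

theorem IsSoundAbstraction.ae_forall_reachesAlmostSurely_imp (h : IsSoundAbstraction β T₁ T₂)
    (U : Set S₂) (μ : Measure S₁) [IsProbabilityMeasure μ] :
    ∀ᵐ ρ ∂T₁.pathMeasure μ, ∀ n, T₂.ReachesAlmostSurely (β (ρ n)) U → ∃ m, n ≤ m ∧ β (ρ m) ∈ U := by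
  have hU : MeasurableSet U := U.to_countable.measurableSet
  have hV : MeasurableSet (β ⁻¹' {y | T₂.ReachesAlmostSurely y U}) :=
    h.1.1 (Set.to_countable _).measurableSet
  have hmeas : MeasurableSet
      {ρ : ℕ → S₁ | T₂.ReachesAlmostSurely (β (ρ 0)) U → ∃ m, ρ m ∈ β ⁻¹' U} :=
    (measurable_pi_apply (X := fun _ => S₁) 0 hV).imp (measurableSet_hits (h.1.1 hU))
  have hstart (x : S₁) : ∀ᵐ ρ ∂T₁.pathKernel x,
      T₂.ReachesAlmostSurely (β (ρ 0)) U → ∃ m, ρ m ∈ β ⁻¹' U := by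
    by_cases hx : T₂.ReachesAlmostSurely (β x) U
    · exact (h.reachesAlmostSurely hU hx).mono fun _ hρ _ => hρ
    · exact (T₁.ae_pathKernel_zero_mem hV.compl hx).mono fun _ hρ hreach => (hρ hreach).elim
  filter_upwards [T₁.ae_pathMeasure_forall_shift hmeas hstart μ] with ρ hρ n hn
  obtain ⟨m, hm⟩ := hρ n hn
  exact ⟨n + m, n.le_add_right m, hm⟩

variable {B : Set S₂}

theorem IsSoundAbstraction.ae_exists_mem_bsccs (h : IsSoundAbstraction β T₁ T₂)
    (hfin : B.Finite) (hB : T₂.IsAttractor B) (μ : Measure S₁) [IsProbabilityMeasure μ] :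
    ∀ᵐ ρ ∂T₁.pathMeasure μ, ∃ C ∈ T₂.bsccs B, ∃ n, β (ρ n) ∈ C := by
  filter_upwards [h.ae_forall_reachesAlmostSurely_imp (⋃₀ T₂.bsccs B) μ] with ρ hρ
  obtain ⟨n, -, C, hC, hn⟩ := hρ 0 (hB.reachesAlmostSurely_sUnion_bsccs hfin _)
  exact ⟨C, hC, n, hn⟩

theorem IsSoundAbstraction.ae_forall_mem_bsccs_eventually_and_frequently
    (h : IsSoundAbstraction β T₁ T₂) (hfin : B.Finite) (hB : T₂.IsAttractor B) (μ : Measure S₁)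
    [IsProbabilityMeasure μ] :
    ∀ᵐ ρ ∂T₁.pathMeasure μ, ∀ C ∈ T₂.bsccs B, (∃ n, β (ρ n) ∈ C) →
      (∀ᶠ m in Filter.atTop, β (ρ m) ∈ T₂.reachableFrom C) ∧
        ∀ t ∈ T₂.reachableFrom C, ∃ᶠ m in Filter.atTop, β (ρ m) = t := by
  filter_upwards [h.1.ae_hasPath μ,
    ae_all_iff.2 fun t : S₂ => h.ae_forall_reachesAlmostSurely_imp {t} μ]
    with ρ hpath hreach C hC ⟨n, hn⟩
  have hstay : ∀ m ≥ n, β (ρ m) ∈ T₂.reachableFrom C := fun m hnm => ⟨_, hn, hpath hnm⟩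
  refine ⟨Filter.eventually_atTop.2 ⟨n, hstay⟩, fun t ht => Filter.frequently_atTop.2 fun k => ?_⟩
  obtain ⟨m, hm, hmt⟩ := hreach t (max n k)
    (hB.reachesAlmostSurely_singleton hfin hC (hstay _ (le_max_left n k)) ht)
  exact ⟨m, (le_max_right n k).trans hm, hmt⟩

theorem IsAbstraction.aedisjoint_hits_of_mem_bsccs (h : IsAbstraction β T₁ T₂) (μ : Measure S₁)
    [IsProbabilityMeasure μ] {C D : Set S₂} (hC : C ∈ T₂.bsccs B) (hD : D ∈ T₂.bsccs B)
    (hCD : C ≠ D) :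
    AEDisjoint (T₁.pathMeasure μ) {ρ | ∃ n, ρ n ∈ β ⁻¹' C} {ρ | ∃ n, ρ n ∈ β ⁻¹' D} := by
  refine measure_mono_null ?_ (ae_iff.1 (h.ae_hasPath μ))
  rintro ρ ⟨⟨n, hn⟩, ⟨m, hm⟩⟩ hpath
  rcases le_total n m with hnm | hmn
  · exact hCD (eq_of_mem_bsccs hC hD hn hm (hpath hnm))
  · exact hCD (eq_of_mem_bsccs hD hC hm hn (hpath hmn)).symm

end Abstraction

end STS

section Muller

/-- The BSCCs `C` of the graph of `B` for which the labels of the states reachable from `C` form a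
set in `𝓕`. For a system whose states carry a single label, these are the good BSCCs for the
Muller condition `𝓕`. -/
def LSTS.mullerBSCCs {AP S : Type*} [MeasurableSpace S] (T : LSTS AP S) (B : Set S)
    (𝓕 : Set (Set AP)) : Set (Set S) :=
  {C ∈ T.bsccs B | ⋃ y ∈ T.reachableFrom C, T.label y ∈ 𝓕}

theorem goodBSCCs_product {AP S Q : Type*} [MeasurableSpace S] [Finite AP] [Finite Q]
    [MeasurableSpace Q] [DiscreteMeasurableSpace Q] (T : LSTS AP S) (M : DMA AP Q)
    (B : Set (S × Q)) (𝓕 : Set (Set Q)) :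
    goodBSCCs (T.product M).toSTS B 𝓕 = (T.product M).mullerBSCCs B 𝓕 := by
  ext C
  have hmem (q : Q) : q ∈ ⋃ y ∈ (T.product M).reachableFrom C, (T.product M).label y ↔
      ∃ s, ∃ c ∈ C, (T.product M).HasPath c (s, q) := by
    rw [Set.mem_iUnion₂]
    constructor
    · rintro ⟨⟨s, _⟩, hs, rfl⟩
      exact ⟨s, hs⟩
    · rintro ⟨s, hs⟩
      exact ⟨(s, q), hs, rfl⟩
  refine and_congr_right fun _ => ⟨?_, fun h => ⟨_, h, fun s q hs => (hmem q).2 ⟨s, hs⟩,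
    fun q hq => (hmem q).1 hq⟩⟩
  rintro ⟨F, hF, hle, hge⟩
  have hlocations : ⋃ y ∈ (T.product M).reachableFrom C, (T.product M).label y = F := by
    ext q
    rw [hmem]
    exact ⟨fun ⟨s, hs⟩ => hle s q hs, hge q⟩
  exact hlocations.symm ▸ hF

variable {AP S₁ S₂ : Type*} [MeasurableSpace S₁] [MeasurableSpace S₂] [Countable S₂]
  [MeasurableSingletonClass S₂] {T₁ : LSTS AP S₁} {T₂ : LSTS AP S₂} {β : S₁ → S₂} {B : Set S₂}

theorem STS.IsSoundAbstraction.ae_inf_eq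
    (hsound : STS.IsSoundAbstraction β T₁.toSTS T₂.toSTS)
    (hlabel : ∀ s, T₂.label (β s) = T₁.label s) (hfin : B.Finite) (hB : T₂.IsAttractor B)
    (μ : Measure S₁) [IsProbabilityMeasure μ] :
    ∀ᵐ ρ ∂T₁.pathMeasure μ, ∀ C ∈ T₂.bsccs B, (∃ n, β (ρ n) ∈ C) →
      T₁.inf ρ = ⋃ y ∈ T₂.reachableFrom C, T₂.label y := by
  filter_upwards [hsound.ae_forall_mem_bsccs_eventually_and_frequently hfin hB μ]
    with ρ hρ C hC hhit
  obtain ⟨hstay, hvisit⟩ := hρ C hC hhit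
  ext a
  rw [LSTS.inf, Set.mem_ofPred_eq, ← Nat.frequently_atTop_iff_infinite, Set.mem_iUnion₂]
  constructor
  · intro ha
    obtain ⟨m, hma, hm⟩ := (ha.and_eventually hstay).exists
    exact ⟨_, hm, (hlabel _).superset hma⟩
  · rintro ⟨y, hy, hay⟩
    refine (hvisit y hy).mono fun m hm => ?_
    rwa [← hlabel, hm]

theorem mainTheorem7_general (hsound : STS.IsSoundAbstraction β T₁.toSTS T₂.toSTS)
    (hlabel : ∀ s, T₂.label (β s) = T₁.label s) (hfin : B.Finite) (hB : T₂.IsAttractor B)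
    (𝓕 : Set (Set AP)) (μ : Measure S₁) [IsProbabilityMeasure μ] :
    T₁.pathMeasure μ {ρ | T₁.inf ρ ∈ 𝓕} =
      ∑' C : T₂.mullerBSCCs B 𝓕, T₁.pathMeasure μ {ρ | ∃ n, ρ n ∈ β ⁻¹' (C : Set S₂)} := by
  have : Countable (T₂.mullerBSCCs B 𝓕) :=
    (hfin.finite_subsets.subset fun C hC => STS.subset_of_mem_bsccs hC.1).countable
  have hmeas (C : Set S₂) : MeasurableSet {ρ : ℕ → S₁ | ∃ n, ρ n ∈ β ⁻¹' C} :=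
    STS.measurableSet_hits (hsound.1.1 C.to_countable.measurableSet)
  rw [← measure_iUnion₀
    (fun C D hCD => hsound.1.aedisjoint_hits_of_mem_bsccs μ C.2.1 D.2.1 (Subtype.coe_ne_coe.2 hCD))
    fun C => (hmeas C).nullMeasurableSet]
  refine measure_congr (Filter.eventuallyEq_set.2 ?_)
  filter_upwards [hsound.ae_exists_mem_bsccs hfin hB μ, hsound.ae_inf_eq hlabel hfin hB μ]
    with ρ ⟨C, hC, hhit⟩ hinf
  simp only [Set.mem_ofPred_eq, Set.mem_iUnion]
  constructor
  · intro hρ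
    exact ⟨⟨C, hC, hinf C hC hhit ▸ hρ⟩, hhit⟩
  · rintro ⟨⟨D, hD, hD𝓕⟩, hhit⟩
    rwa [hinf D hD hhit]

end Muller

theorem mainTheorem7 {AP S₁ S₂ Q : Type*} [Finite AP]
    [MeasurableSpace S₁]
    [MeasurableSpace S₂] [Countable S₂] [DiscreteMeasurableSpace S₂]
    [Finite Q] [MeasurableSpace Q] [DiscreteMeasurableSpace Q]
    (T₁ : LSTS AP S₁) (T₂ : LSTS AP S₂) (α : S₁ → S₂)
    (habs : LSTS.IsAbstraction α T₁ T₂)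
    (hfin : ∃ A : Set S₂, A.Finite ∧ T₂.toSTS.IsAttractor A)
    (M : DMA AP Q)
    (hsound : STS.IsSoundAbstraction (liftProd Q α)
      (T₁.product M).toSTS (T₂.product M).toSTS)
    (B₂ : Set (S₂ × Q)) (hB₂fin : B₂.Finite)
    (hB₂ : (T₂.product M).toSTS.IsAttractor B₂)
    (μ : Measure S₁) [IsProbabilityMeasure μ] :
    (T₁.product M).toSTS.pathMeasure (μ.prod (Measure.dirac M.init))
        {ρ | (T₁.product M).inf ρ ∈ M.muller} =
      ∑' C : goodBSCCs (T₂.product M).toSTS B₂ M.muller,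
        (T₁.product M).toSTS.pathMeasure (μ.prod (Measure.dirac M.init))
          {ρ | ∃ n, ρ n ∈ liftProd Q α ⁻¹' (C : Set (S₂ × Q))} := by
  rw [goodBSCCs_product]
  exact mainTheorem7_general hsound (fun _ => rfl) hB₂fin hB₂ _ _
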